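/- \textbf{Theorem (Replication of state).} Quantum systems are described by complex Hilbert spaces of arbitrary dimension. For a Hilbert space $\mathcal H$ let $\mathcal T(\mathcal H)$ be the space of trace-class operators, $\|T\|_1=\operatorname{tr}\sqrt{T^\dagger T}$ the trace norm, and $\mathcal D(\mathcal H)$ the set of density operators; let $\mathcal C(\mathcal H\to\mathcal K)$ be the set of completely positive, trace-preserving linear maps $\mathcal T(\mathcal H)\to\mathcal T(\mathcal K)$. Fix a class of quantum systems that contains the trivial system $\mathbb C$ and is closed under (Hilbert space) tensor products, and to every pair of systems $\mathcal H,\mathcal K$ let a set $\mathcal O(\mathcal H\to\mathcal K)\subseteq\mathcal C(\mathcal H\to\mathcal K)$ of \emph{free operations} be assigned such that, for all systems, \begin{enumerate} \item $\mathcal N\circ\mathcal M\in\mathcal O(\mathcal H_1\to\mathcal H_3)$ whenever $\mathcal M\in\mathcal O(\mathcal H_1\to\mathcal H_2)$ and $\mathcal N\in\mathcal O(\mathcal H_2\to\mathcal H_3)$; \item $\mathcal M\otimes\mathcal N\in\mathcal O(\mathcal H_1\otimes\mathcal H_2\to\mathcal K_1\otimes\mathcal K_2)$ whenever $\mathcal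 M\in\mathcal O(\mathcal H_1\to\mathcal K_1)$ and $\mathcal N\in\mathcal O(\mathcal H_2\to\mathcal K_2)$; \item $\mathrm{id}\in\mathcal O(\mathcal H\to\mathcal H)$; \item $\operatorname{tr}\in\mathcal O(\mathcal H\to\mathbb C)$. \end{enumerate} Here, as usual, $(\mathcal H_1\otimes\mathcal H_2)\otimes\mathcal H_3$ is identified with $\mathcal H_1\otimes(\mathcal H_2\otimes\mathcal H_3)$, and $\mathcal H\otimes\mathbb C$ and $\mathbb C\otimes\mathcal H$ with $\mathcal H$; that is, these canonical isomorphisms and their inverses are free operations. For systems $\mathcal H_1,\mathcal H_2$, $\phi\in\mathcal D(\mathcal H_1)$ and $\psi\in\mathcal D(\mathcal H_2)$, let $\mathcal R(\phi\to\psi)$ be the set of all real $r\ge 0$ for which there are free operations $\mathcal N_n\in\mathcal O(\mathcal H_1^{\otimes n}\to\mathcal H_2^{\otimes\lceil rn\rceil})$, $n\in\mathbb N$, with \[\liminf_{n\to\infty}\bigl\|\mathcal N_n(\phi^{\otimes n})-\psi^{\otimes\lceil rn\rceil}\bigr\|_1=0,\] where $\mathcal H^{\otimes 0}=\mathbb C$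 and $\phi^{\otimes 0}=1$, and let $r_{\mathrm{conv}}(\phi\to\psi)=\sup\mathcal R(\phi\to\psi)\in[0,\infty]$ be the asymptotic conversion rate. Then for every system $\mathcal H$ and every state $\psi\in\mathcal D(\mathcal H)$, the rate $r_{\mathrm{conv}}(\psi\to\psi)$ is equal to either $1$ or $+\infty$. -/

import Mathlib

open scoped NNReal ENNReal InnerProductSpace TensorProduct ComplexOrder

universe u v

set_option linter.unusedSectionVars false

noncomputable section

namespace QRT

section TraceClass

variable {H : Type*} [NormedAddCommGroup H] [InnerProductSpace ℂ H] [CompleteSpace H]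

/-- The index set of a fixed orthonormal basis of `H`. -/
def basisIndex (H : Type*) [NormedAddCommGroup H] [InnerProductSpace ℂ H] [CompleteSpace H] :
    Set H :=
  (exists_hilbertBasis ℂ H).choose

/-- A fixed orthonormal basis of `H` (traces do not depend on it). -/
def basis (H : Type*) [NormedAddCommGroup H] [InnerProductSpace ℂ H] [CompleteSpace H] :
    HilbertBasis (basisIndex H) ℂ H :=
  (exists_hilbertBasis ℂ H).choose_spec.choose

/-- The trace norm `‖T‖₁ = tr |T|` with `|T| = √(T† T)`, as an element of `[0, ∞]`. -/
def traceNorm (T : H →L[ℂ] H) : ℝ≥0∞ :=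
  ∑' i, ENNReal.ofReal (RCLike.re ⟪basis H i, CFC.abs T (basis H i)⟫_ℂ)

theorem enorm_sq_eq_tsum {ι : Type*} (b : HilbertBasis ι ℂ H) (x : H) :
    ‖x‖ₑ ^ 2 = ∑' i, ‖⟪b i, x⟫_ℂ‖ₑ ^ 2 := by
  have h := b.hasSum_inner_mul_inner x x
  have h2 : HasSum (fun i => ‖⟪b i, x⟫_ℂ‖ ^ 2) (‖x‖ ^ 2) := by
    have h3 := Complex.hasSum_re h
    have h4 : (⟪x, x⟫_ℂ).re = ‖x‖ ^ 2 := by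
      have := inner_self_eq_norm_sq (𝕜 := ℂ) x
      simpa using this
    rw [h4] at h3
    refine h3.congr_fun ?_ |> fun h => h
    intro i
    rw [← inner_conj_symm x (b i), Complex.conj_mul']
    norm_cast
  have h5 : ENNReal.ofReal (‖x‖ ^ 2) = ∑' i, ENNReal.ofReal (‖⟪b i, x⟫_ℂ‖ ^ 2) := by
    rw [← h2.tsum_eq, ENNReal.ofReal_tsum_of_nonneg (fun _ => by positivity) h2.summable]
  simpa [ENNReal.ofReal_pow, ofReal_norm] using h5

/-- The squared Hilbert–Schmidt norm is the same in all bases and for the adjoint. -/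
theorem tsum_enorm_sq_adjoint {ι κ : Type*} (b : HilbertBasis ι ℂ H) (c : HilbertBasis κ ℂ H)
    (A : H →L[ℂ] H) : ∑' i, ‖A (b i)‖ₑ ^ 2 = ∑' j, ‖(star A) (c j)‖ₑ ^ 2 := by
  simp_rw [enorm_sq_eq_tsum c (A _), enorm_sq_eq_tsum b (star A _)]
  rw [ENNReal.tsum_comm]
  refine tsum_congr fun j => tsum_congr fun i => ?_
  rw [ContinuousLinearMap.star_eq_adjoint, ContinuousLinearMap.adjoint_inner_right,
    ← inner_conj_symm (A (b i)), ← ofReal_norm, ← ofReal_norm, RCLike.norm_conj]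

theorem tsum_enorm_sq_basis {ι κ : Type*} (b : HilbertBasis ι ℂ H) (c : HilbertBasis κ ℂ H)
    (A : H →L[ℂ] H) : ∑' i, ‖A (b i)‖ₑ ^ 2 = ∑' j, ‖A (c j)‖ₑ ^ 2 := by
  rw [tsum_enorm_sq_adjoint b b, tsum_enorm_sq_adjoint b c, star_star]

theorem inner_eq_sqrt {P : H →L[ℂ] H} (hP : 0 ≤ P) (x y : H) :
    ⟪x, P y⟫_ℂ = ⟪CFC.sqrt P x, CFC.sqrt P y⟫_ℂ := by
  have h : star (CFC.sqrt P) = CFC.sqrt P := (CFC.sqrt_nonneg P).isSelfAdjoint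
  conv_lhs => rw [← CFC.sqrt_mul_sqrt_self P hP]
  conv_rhs => rw [← h, ContinuousLinearMap.star_eq_adjoint,
    ContinuousLinearMap.adjoint_inner_left, ← ContinuousLinearMap.star_eq_adjoint, h]
  rfl

theorem ofReal_re_inner {P : H →L[ℂ] H} (hP : 0 ≤ P) (x : H) :
    ENNReal.ofReal (RCLike.re ⟪x, P x⟫_ℂ) = ‖CFC.sqrt P x‖ₑ ^ 2 := by
  rw [inner_eq_sqrt hP, inner_self_eq_norm_sq, ENNReal.ofReal_pow (norm_nonneg _), ofReal_norm]

theorem traceNorm_eq_tsum_sq {ι : Type*} (b : HilbertBasis ι ℂ H) (T : H →L[ℂ] H) :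
    traceNorm T = ∑' i, ‖CFC.sqrt (CFC.abs T) (b i)‖ₑ ^ 2 := by
  rw [← tsum_enorm_sq_basis (basis H) b]
  exact tsum_congr fun i => ofReal_re_inner (CFC.abs_nonneg T) _

/-- The trace norm can be computed in any orthonormal basis. -/
theorem traceNorm_eq {ι : Type*} (b : HilbertBasis ι ℂ H) (T : H →L[ℂ] H) :
    traceNorm T = ∑' i, ENNReal.ofReal (RCLike.re ⟪b i, CFC.abs T (b i)⟫_ℂ) := by
  rw [traceNorm_eq_tsum_sq b]
  exact tsum_congr fun i => (ofReal_re_inner (CFC.abs_nonneg T) _).symm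

theorem norm_abs_apply (T : H →L[ℂ] H) (x : H) : ‖CFC.abs T x‖ = ‖T x‖ := by
  have h : star (CFC.abs T) = CFC.abs T := (CFC.abs_nonneg T).isSelfAdjoint
  have key : ⟪CFC.abs T x, CFC.abs T x⟫_ℂ = ⟪T x, T x⟫_ℂ := by
    rw [← ContinuousLinearMap.adjoint_inner_right, ← ContinuousLinearMap.star_eq_adjoint, h,
      ← ContinuousLinearMap.adjoint_inner_right T, ← ContinuousLinearMap.star_eq_adjoint]
    exact congrArg (fun S : H →L[ℂ] H => ⟪x, S x⟫_ℂ) (CFC.abs_mul_abs T)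
  have h2 := congrArg RCLike.re key
  rw [inner_self_eq_norm_sq, inner_self_eq_norm_sq] at h2
  exact (sq_eq_sq₀ (norm_nonneg _) (norm_nonneg _)).1 h2

/-- Polar decomposition: `T = V |T|` and `|T| = V† T` for some contraction `V`. -/
theorem exists_polar (T : H →L[ℂ] H) : ∃ V : H →L[ℂ] H, (∀ x, ‖V x‖ ≤ ‖x‖) ∧
    V * CFC.abs T = T ∧ star V * T = CFC.abs T := by
  let M : Submodule ℂ H := (CFC.abs T).range.topologicalClosure
  let e : H →ₗ[ℂ] M := LinearMap.codRestrict M (CFC.abs T).toLinearMap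
    (fun x => Submodule.le_topologicalClosure _ ⟨x, rfl⟩)
  have he : DenseRange e := by
    intro y
    rw [Metric.mem_closure_iff]
    intro ε hε
    obtain ⟨z, ⟨x, rfl⟩, hz⟩ := Metric.mem_closure_iff.1 y.2 ε hε
    exact ⟨e x, ⟨x, rfl⟩, hz⟩
  have hn : ∀ x, ‖T.toLinearMap x‖ ≤ 1 * ‖e x‖ := fun x => by
    rw [one_mul]; exact (norm_abs_apply T x).ge
  let W : M →L[ℂ] H := T.toLinearMap.extendOfNorm e
  let V : H →L[ℂ] H := W ∘L M.orthogonalProjectionOnto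
  have hV : ∀ x, ‖V x‖ ≤ ‖x‖ := fun x => by
    have h1 := LinearMap.norm_extendOfNorm_apply_le he 1 hn (M.orthogonalProjectionOnto x)
    rw [one_mul] at h1
    exact h1.trans (M.norm_orthogonalProjectionOnto_apply_le x)
  have hVT : ∀ x, V (CFC.abs T x) = T x := fun x => by
    have h1 : M.orthogonalProjectionOnto (CFC.abs T x) = e x :=
      M.orthogonalProjectionOnto_mem_subspace_eq_self (e x)
    change W (M.orthogonalProjectionOnto (CFC.abs T x)) = T x
    rw [h1]
    exact LinearMap.extendOfNorm_eq he ⟨1, hn⟩ x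
  refine ⟨V, hV, ContinuousLinearMap.ext hVT, ContinuousLinearMap.ext fun x => ?_⟩
  have hst : ∀ y, ‖star V y‖ ≤ ‖y‖ := fun y => by
    have h1 : ‖V‖ ≤ 1 := V.opNorm_le_bound zero_le_one (by simpa using hV)
    have h2 := (star V).le_opNorm y
    rw [norm_star] at h2
    exact h2.trans (mul_le_of_le_one_left (norm_nonneg _) h1)
  change star V (T x) = CFC.abs T x
  rw [← sub_eq_zero, ← norm_eq_zero, ← sq_eq_zero_iff]
  refine le_antisymm ?_ (sq_nonneg _)
  rw [@norm_sub_sq ℂ]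
  have h1 : RCLike.re ⟪star V (T x), CFC.abs T x⟫_ℂ = ‖T x‖ ^ 2 := by
    rw [ContinuousLinearMap.star_eq_adjoint, ContinuousLinearMap.adjoint_inner_left, hVT,
      inner_self_eq_norm_sq]
  rw [h1, norm_abs_apply]
  have := pow_le_pow_left₀ (norm_nonneg _) (hst (T x)) 2
  linarith

theorem tsum_re_inner_le {C : H →L[ℂ] H} (hC : ∀ x, ‖C x‖ ≤ ‖x‖) (A : H →L[ℂ] H) :
    ∑' i, ENNReal.ofReal (RCLike.re ⟪basis H i, C (CFC.abs A (basis H i))⟫_ℂ) ≤ traceNorm A := by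
  set S := CFC.sqrt (CFC.abs A) with hS
  have hsa : star S = S := (CFC.sqrt_nonneg _).isSelfAdjoint
  have h1 : ∀ x : H, 2 * ENNReal.ofReal (RCLike.re ⟪x, C (CFC.abs A x)⟫_ℂ)
      ≤ ‖(S * star C) x‖ₑ ^ 2 + ‖S x‖ₑ ^ 2 := fun x => by
    have h2 : ⟪x, C (CFC.abs A x)⟫_ℂ = ⟪(S * star C) x, S x⟫_ℂ := by
      rw [← ContinuousLinearMap.adjoint_inner_left, inner_eq_sqrt (CFC.abs_nonneg A)]
      rfl
    have h3 : 2 * RCLike.re ⟪(S * star C) x, S x⟫_ℂ ≤ ‖(S * star C) x‖ ^ 2 + ‖S x‖ ^ 2 := by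
      have := re_inner_le_norm (𝕜 := ℂ) ((S * star C) x) (S x)
      nlinarith [sq_nonneg (‖(S * star C) x‖ - ‖S x‖)]
    rw [h2]
    have h4 := ENNReal.ofReal_le_ofReal h3
    rw [ENNReal.ofReal_mul (by norm_num), ENNReal.ofReal_add (by positivity) (by positivity),
      ENNReal.ofReal_pow (norm_nonneg _), ENNReal.ofReal_pow (norm_nonneg _), ofReal_norm,
      ofReal_norm] at h4
    simpa using h4
  have h5 : ∑' i, ‖(S * star C) (basis H i)‖ₑ ^ 2 ≤ traceNorm A := by
    rw [tsum_enorm_sq_adjoint (basis H) (basis H), star_mul, star_star, hsa,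
      traceNorm_eq_tsum_sq (basis H)]
    refine ENNReal.tsum_le_tsum fun i => ?_
    gcongr
    exact enorm_le_iff_norm_le.2 (hC _)
  have h6 : 2 * ∑' i, ENNReal.ofReal (RCLike.re ⟪basis H i, C (CFC.abs A (basis H i))⟫_ℂ)
      ≤ 2 * traceNorm A := by
    rw [← ENNReal.tsum_mul_left]
    refine (ENNReal.tsum_le_tsum fun i => h1 (basis H i)).trans ?_
    rw [ENNReal.tsum_add, ← traceNorm_eq_tsum_sq (basis H), two_mul]
    gcongr
  exact (ENNReal.mul_le_mul_iff_right (by norm_num) (by norm_num)).1 h6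

theorem traceNorm_add_le (A B : H →L[ℂ] H) :
    traceNorm (A + B) ≤ traceNorm A + traceNorm B := by
  obtain ⟨V, hV, -, hVT⟩ := exists_polar (A + B)
  obtain ⟨VA, hVA, hA, -⟩ := exists_polar A
  obtain ⟨VB, hVB, hB, -⟩ := exists_polar B
  have hst : ∀ y, ‖star V y‖ ≤ ‖y‖ := fun y => by
    have h1 : ‖V‖ ≤ 1 := V.opNorm_le_bound zero_le_one (by simpa using hV)
    have h2 := (star V).le_opNorm y
    rw [norm_star] at h2
    exact h2.trans (mul_le_of_le_one_left (norm_nonneg _) h1)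
  refine le_trans ?_ (add_le_add
    (tsum_re_inner_le (C := star V * VA) (fun x => (hst _).trans (hVA x)) A)
    (tsum_re_inner_le (C := star V * VB) (fun x => (hst _).trans (hVB x)) B))
  rw [← ENNReal.tsum_add]
  refine ENNReal.tsum_le_tsum fun i => ?_
  refine le_trans ?_ ENNReal.ofReal_add_le
  apply ENNReal.ofReal_le_ofReal
  rw [← hVT, ← map_add, ← inner_add_right]
  have h1 : ∀ x, VA (CFC.abs A x) = A x := fun x => congrArg (fun S : H →L[ℂ] H => S x) hA
  have h2 : ∀ x, VB (CFC.abs B x) = B x := fun x => congrArg (fun S : H →L[ℂ] H => S x) hB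
  simp [h1, h2, inner_add_right]

theorem traceNorm_smul (c : ℂ) (A : H →L[ℂ] H) : traceNorm (c • A) = ‖c‖ₑ * traceNorm A := by
  unfold traceNorm
  rw [← ENNReal.tsum_mul_left]
  refine tsum_congr fun i => ?_
  rw [CFC.abs_smul, ← ofReal_norm, ← ENNReal.ofReal_mul (norm_nonneg _)]
  congr 1
  simp

/-- The space `𝒯(H)` of trace-class operators on `H`. -/
def traceClass (H : Type*) [NormedAddCommGroup H] [InnerProductSpace ℂ H] [CompleteSpace H] :
    Submodule ℂ (H →L[ℂ] H) where
  carrier := {T | traceNorm T < ⊤}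
  zero_mem' := by simp [traceNorm]
  add_mem' ha hb := (traceNorm_add_le _ _).trans_lt (ENNReal.add_lt_top.2 ⟨ha, hb⟩)
  smul_mem' c A hA := by
    change traceNorm (c • A) < ⊤
    rw [traceNorm_smul]
    exact ENNReal.mul_lt_top (by simp) hA

/-- The trace of a trace-class operator. -/
def trace (T : traceClass H) : ℂ :=
  ∑' i, ⟪basis H i, (T : H →L[ℂ] H) (basis H i)⟫_ℂ

end TraceClass

/-- The set `𝒟(H)` of density operators on `H`. -/
structure DensityOperator (H : Type*) [NormedAddCommGroup H] [InnerProductSpace ℂ H]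
    [CompleteSpace H] where
  op : traceClass H
  nonneg : 0 ≤ (op : H →L[ℂ] H)
  trace_eq_one : trace op = 1

section Channel

variable {H K L : Type*} [NormedAddCommGroup H] [InnerProductSpace ℂ H] [CompleteSpace H]
  [NormedAddCommGroup K] [InnerProductSpace ℂ K] [CompleteSpace K]
  [NormedAddCommGroup L] [InnerProductSpace ℂ L] [CompleteSpace L]

/-- The block matrix `(T i j)` of trace-class operators is positive semidefinite on `H ⊕ ⋯ ⊕ H`. -/
def BlockNonneg {n : ℕ} (T : Fin n → Fin n → traceClass H) : Prop :=
  ∀ v : Fin n → H, 0 ≤ ∑ i, ∑ j, ⟪v i, (T i j : H →L[ℂ] H) (v j)⟫_ℂ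

/-- The set `𝒞(H → K)` of quantum channels: completely positive and trace-preserving linear maps
`𝒯(H) → 𝒯(K)`. -/
structure Channel (H K : Type*) [NormedAddCommGroup H] [InnerProductSpace ℂ H] [CompleteSpace H]
    [NormedAddCommGroup K] [InnerProductSpace ℂ K] [CompleteSpace K] where
  toLin : traceClass H →ₗ[ℂ] traceClass K
  completely_positive : ∀ (n : ℕ) (T : Fin n → Fin n → traceClass H),
    BlockNonneg T → BlockNonneg fun i j => toLin (T i j)
  trace_preserving : ∀ T, trace (toLin T) = trace T

instance : CoeFun (Channel H K) fun _ => traceClass H → traceClass K := ⟨fun E => E.toLin⟩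

/-- The identity channel. -/
def Channel.id (H : Type*) [NormedAddCommGroup H] [InnerProductSpace ℂ H] [CompleteSpace H] :
    Channel H H where
  toLin := LinearMap.id
  completely_positive _ _ h := h
  trace_preserving _ := rfl

/-- Composition of channels. -/
def Channel.comp (F : Channel K L) (E : Channel H K) : Channel H L where
  toLin := F.toLin ∘ₗ E.toLin
  completely_positive n T h := F.completely_positive n _ (E.completely_positive n T h)
  trace_preserving T := (F.trace_preserving _).trans (E.trace_preserving T)

end Channel

section Tensor

/-- The Hilbert space tensor product: the completion of the algebraic tensor product with
`⟪x ⊗ y, x' ⊗ y'⟫ = ⟪x, x'⟫ ⟪y, y'⟫`. -/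
abbrev HilbertTensor (H K : Type*) [NormedAddCommGroup H] [InnerProductSpace ℂ H]
    [NormedAddCommGroup K] [InnerProductSpace ℂ K] : Type _ :=
  UniformSpace.Completion (H ⊗[ℂ] K)

variable {H K L : Type*} [NormedAddCommGroup H] [InnerProductSpace ℂ H] [CompleteSpace H]
  [NormedAddCommGroup K] [InnerProductSpace ℂ K] [CompleteSpace K]
  [NormedAddCommGroup L] [InnerProductSpace ℂ L] [CompleteSpace L]

/-- The operator `A ⊗ B` on `L`, where `L` is identified with `H ⊗ K` through the unitary `U`. -/
def opTensor (U : HilbertTensor H K ≃ₗᵢ[ℂ] L) (A : H →L[ℂ] H) (B : K →L[ℂ] K) : L →L[ℂ] L :=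
  U.toContinuousLinearEquiv.toContinuousLinearMap ∘L
    (TensorProduct.mapL A B).completion ∘L
    U.symm.toContinuousLinearEquiv.toContinuousLinearMap

/-- The vector `x ⊗ y`, seen in `L`. -/
def vecTensor (U : HilbertTensor H K ≃ₗᵢ[ℂ] L) (x : H) (y : K) : L :=
  U ((x ⊗ₜ[ℂ] y : H ⊗[ℂ] K) : HilbertTensor H K)

theorem opTensor_vecTensor (U : HilbertTensor H K ≃ₗᵢ[ℂ] L) (A : H →L[ℂ] H) (B : K →L[ℂ] K)
    (x : H) (y : K) : opTensor U A B (vecTensor U x y) = vecTensor U (A x) (B y) := by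
  simp [opTensor, vecTensor]

theorem inner_vecTensor (U : HilbertTensor H K ≃ₗᵢ[ℂ] L) (x x' : H) (y y' : K) :
    ⟪vecTensor U x y, vecTensor U x' y'⟫_ℂ = ⟪x, x'⟫_ℂ * ⟪y, y'⟫_ℂ := by
  simp [vecTensor]

theorem ext_vecTensor {G : Type*} [NormedAddCommGroup G] [NormedSpace ℂ G]
    (U : HilbertTensor H K ≃ₗᵢ[ℂ] L) {S T : L →L[ℂ] G}
    (h : ∀ x y, S (vecTensor U x y) = T (vecTensor U x y)) : S = T := by
  ext z
  obtain ⟨w, rfl⟩ := U.surjective z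
  induction w using UniformSpace.Completion.induction_on with
  | hp => exact isClosed_eq (by fun_prop) (by fun_prop)
  | ih a =>
    induction a using TensorProduct.induction_on with
    | zero => rw [UniformSpace.Completion.coe_zero, map_zero, map_zero, map_zero]
    | tmul x y => exact h x y
    | add a b ha hb =>
      rw [UniformSpace.Completion.coe_add, map_add, map_add, map_add, ha, hb]

theorem opTensor_mul (U : HilbertTensor H K ≃ₗᵢ[ℂ] L) (A A' : H →L[ℂ] H) (B B' : K →L[ℂ] K) :
    opTensor U A B * opTensor U A' B' = opTensor U (A * A') (B * B') := by
  refine ext_vecTensor U fun x y => ?_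
  change opTensor U A B (opTensor U A' B' _) = _
  rw [opTensor_vecTensor, opTensor_vecTensor, opTensor_vecTensor]
  rfl

theorem opTensor_star (U : HilbertTensor H K ≃ₗᵢ[ℂ] L) (A : H →L[ℂ] H) (B : K →L[ℂ] K) :
    star (opTensor U A B) = opTensor U (star A) (star B) := by
  refine ext_vecTensor U fun x y => ?_
  refine ext_inner_left ℂ fun z => ?_
  have key : (innerSL ℂ (star (opTensor U A B) (vecTensor U x y))) =
      innerSL ℂ (opTensor U (star A) (star B) (vecTensor U x y)) := by
    refine ext_vecTensor U fun x' y' => ?_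
    simp only [innerSL_apply_apply, ContinuousLinearMap.star_eq_adjoint,
      ContinuousLinearMap.adjoint_inner_left, opTensor_vecTensor, inner_vecTensor]
  have := congrArg (fun S : L →L[ℂ] ℂ => S z) key
  simp only [innerSL_apply_apply] at this
  rw [← inner_conj_symm, this, inner_conj_symm]

theorem sqrt_opTensor (U : HilbertTensor H K ≃ₗᵢ[ℂ] L) {P : H →L[ℂ] H} {Q : K →L[ℂ] K}
    (hP : 0 ≤ P) (hQ : 0 ≤ Q) (hPQ : 0 ≤ opTensor U (CFC.sqrt P) (CFC.sqrt Q)) :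
    CFC.sqrt (opTensor U P Q) = opTensor U (CFC.sqrt P) (CFC.sqrt Q) := by
  refine CFC.sqrt_unique ?_ hPQ
  rw [opTensor_mul, CFC.sqrt_mul_sqrt_self P hP, CFC.sqrt_mul_sqrt_self Q hQ]

theorem opTensor_nonneg (U : HilbertTensor H K ≃ₗᵢ[ℂ] L) {P : H →L[ℂ] H} {Q : K →L[ℂ] K}
    (hP : 0 ≤ P) (hQ : 0 ≤ Q) : 0 ≤ opTensor U P Q := by
  have h1 : star (CFC.sqrt P) = CFC.sqrt P := (CFC.sqrt_nonneg P).isSelfAdjoint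
  have h2 : star (CFC.sqrt Q) = CFC.sqrt Q := (CFC.sqrt_nonneg Q).isSelfAdjoint
  have h : opTensor U P Q =
      star (opTensor U (CFC.sqrt P) (CFC.sqrt Q)) * opTensor U (CFC.sqrt P) (CFC.sqrt Q) := by
    rw [opTensor_star, opTensor_mul, h1, h2, CFC.sqrt_mul_sqrt_self P hP,
      CFC.sqrt_mul_sqrt_self Q hQ]
  rw [h]
  exact star_mul_self_nonneg _

theorem abs_opTensor (U : HilbertTensor H K ≃ₗᵢ[ℂ] L) (A : H →L[ℂ] H) (B : K →L[ℂ] K) :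
    CFC.abs (opTensor U A B) = opTensor U (CFC.abs A) (CFC.abs B) := by
  refine CFC.sqrt_unique ?_ (opTensor_nonneg U (CFC.abs_nonneg A) (CFC.abs_nonneg B))
  rw [opTensor_mul, opTensor_star, opTensor_mul, CFC.abs_mul_abs, CFC.abs_mul_abs]

/-- The product orthonormal basis `(b i ⊗ c j)` of the tensor product. -/
def tensorBasis {ι κ : Type*} (U : HilbertTensor H K ≃ₗᵢ[ℂ] L) (b : HilbertBasis ι ℂ H)
    (c : HilbertBasis κ ℂ K) : HilbertBasis (ι × κ) ℂ L :=
  HilbertBasis.mkOfOrthogonalEqBot (v := fun p : ι × κ => vecTensor U (b p.1) (c p.2))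
    (by
      classical
      rw [orthonormal_iff_ite]
      rintro ⟨i, j⟩ ⟨i', j'⟩
      rw [inner_vecTensor, orthonormal_iff_ite.1 b.orthonormal, orthonormal_iff_ite.1 c.orthonormal]
      by_cases h1 : i = i' <;> by_cases h2 : j = j' <;> simp [h1, h2])
    (by
      rw [Submodule.eq_bot_iff]
      intro x hx
      let D : H →L[ℂ] K →L[ℂ] L :=
        (ContinuousLinearMap.compL ℂ K (H ⊗[ℂ] K) L
          (U.toContinuousLinearEquiv.toContinuousLinearMap ∘L
            UniformSpace.Completion.toComplL)) ∘L TensorProduct.mkL ℂ H K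
      have hD : ∀ y z, D y z = vecTensor U y z := fun y z => rfl
      have h0 : ∀ i j, ⟪x, vecTensor U (b i) (c j)⟫_ℂ = 0 := fun i j =>
        (Submodule.mem_orthogonal' _ _).1 hx _ (Submodule.subset_span ⟨(i, j), rfl⟩)
      have hb : Dense (Submodule.span ℂ (Set.range b) : Set H) :=
        Submodule.dense_iff_topologicalClosure_eq_top.2 b.dense_span
      have hc : Dense (Submodule.span ℂ (Set.range c) : Set K) :=
        Submodule.dense_iff_topologicalClosure_eq_top.2 c.dense_span
      have h1 : ∀ i y, ⟪x, vecTensor U (b i) y⟫_ℂ = 0 := fun i y => by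
        have : innerSL ℂ x ∘L D (b i) = 0 := by
          refine ContinuousLinearMap.ext_on hc ?_
          rintro _ ⟨j, rfl⟩
          exact h0 i j
        exact congrArg (fun S : K →L[ℂ] ℂ => S y) this
      have h2 : ∀ z y, ⟪x, vecTensor U z y⟫_ℂ = 0 := fun z y => by
        have : innerSL ℂ x ∘L D.flip y = 0 := by
          refine ContinuousLinearMap.ext_on hb ?_
          rintro _ ⟨j, rfl⟩
          exact h1 j y
        exact congrArg (fun S : H →L[ℂ] ℂ => S z) this
      have h3 : innerSL ℂ x = 0 := ext_vecTensor U fun z y => h2 z y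
      have h4 := congrArg (fun S : L →L[ℂ] ℂ => S x) h3
      exact inner_self_eq_zero.1 h4)

theorem tensorBasis_apply {ι κ : Type*} (U : HilbertTensor H K ≃ₗᵢ[ℂ] L) (b : HilbertBasis ι ℂ H)
    (c : HilbertBasis κ ℂ K) (p : ι × κ) :
    tensorBasis U b c p = vecTensor U (b p.1) (c p.2) := by
  simp [tensorBasis]

/-- Multiplicativity of the trace norm. -/
theorem traceNorm_opTensor (U : HilbertTensor H K ≃ₗᵢ[ℂ] L) (A : H →L[ℂ] H) (B : K →L[ℂ] K) :
    traceNorm (opTensor U A B) = traceNorm A * traceNorm B := by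
  have hA := CFC.abs_nonneg A
  have hB := CFC.abs_nonneg B
  rw [traceNorm_eq_tsum_sq (tensorBasis U (basis H) (basis K)), traceNorm_eq_tsum_sq (basis H),
    traceNorm_eq_tsum_sq (basis K), abs_opTensor, sqrt_opTensor U hA hB
      (opTensor_nonneg U (CFC.sqrt_nonneg _) (CFC.sqrt_nonneg _)), ENNReal.tsum_prod',
    ← ENNReal.tsum_mul_right]
  refine tsum_congr fun i => ?_
  rw [← ENNReal.tsum_mul_left]
  refine tsum_congr fun j => ?_
  rw [tensorBasis_apply, opTensor_vecTensor, ← mul_pow]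
  congr 1
  rw [vecTensor, U.enorm_map, UniformSpace.Completion.enorm_coe, TensorProduct.enorm_tmul]

/-- The trace-class operator `A ⊗ B`. -/
def tensorOp (U : HilbertTensor H K ≃ₗᵢ[ℂ] L) (A : traceClass H) (B : traceClass K) :
    traceClass L :=
  ⟨opTensor U A B, by
    change traceNorm _ < ⊤
    rw [traceNorm_opTensor]
    exact ENNReal.mul_lt_top A.2 B.2⟩

/-- On a one-dimensional space the identity operator is trace class. -/
theorem one_mem_traceClass (h : Module.finrank ℂ H = 1) : (1 : H →L[ℂ] H) ∈ traceClass H := by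
  have : FiniteDimensional ℂ H := Module.finite_of_finrank_pos (by omega)
  change traceNorm 1 < ⊤
  rw [traceNorm_eq (stdOrthonormalBasis ℂ H).toHilbertBasis, tsum_fintype]
  exact ENNReal.sum_lt_top.2 fun _ _ => ENNReal.ofReal_lt_top

end Tensor

/-- A quantum resource theory, given by its free operations.

The quantum systems are the elements of `Sys`; the system `a` has the complex Hilbert space
`space a`, of any dimension. The composite `tens a b` has the tensor product of the Hilbert spaces
of its parts, and `one` is the trivial system `ℂ`. (All Hilbert spaces may be taken as systems, but
also, e.g., only the finite-dimensional ones, or Hilbert spaces with a bipartition.)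

`free a b` is the set of free operations from `a` to `b`. The first four axioms are those of a
resource theory; the others say that the usual identifications of `(a ⊗ b) ⊗ c` with `a ⊗ (b ⊗ c)`
and of `a ⊗ ℂ` and `ℂ ⊗ a` with `a` are free. A channel on a tensor product is determined by its
values on product operators, so the channels in these axioms are unique. -/
structure ResourceTheory where
  Sys : Type v
  space : Sys → Type u
  [normed : ∀ a, NormedAddCommGroup (space a)]
  [innerProduct : ∀ a, InnerProductSpace ℂ (space a)]
  [complete : ∀ a, CompleteSpace (space a)]
  tens : Sys → Sys → Sys
  one : Sys
  tensIso : ∀ a b, HilbertTensor (space a) (space b) ≃ₗᵢ[ℂ] space (tens a b)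
  finrank_one : Module.finrank ℂ (space one) = 1
  free : ∀ a b, Set (Channel (space a) (space b))
  /-- Free operations compose. -/
  comp_mem : ∀ {a b c} {M : Channel (space a) (space b)} {N : Channel (space b) (space c)},
    M ∈ free a b → N ∈ free b c → N.comp M ∈ free a c
  /-- `M ⊗ N` is free if `M` and `N` are. -/
  tensor_mem : ∀ {a b c d} {M : Channel (space a) (space b)} {N : Channel (space c) (space d)},
    M ∈ free a b → N ∈ free c d → ∃ G ∈ free (tens a c) (tens b d), ∀ ρ σ,
      G (tensorOp (tensIso a c) ρ σ) = tensorOp (tensIso b d) (M ρ) (N σ)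
  /-- The identity map is free. -/
  id_mem : ∀ a, Channel.id (space a) ∈ free a a
  /-- The trace is free. -/
  trace_mem : ∀ a, ∃ G ∈ free a one, ∀ ρ, (G ρ : space one →L[ℂ] space one) = trace ρ • 1
  assoc_mem : ∀ a b c, ∃ G ∈ free (tens (tens a b) c) (tens a (tens b c)), ∀ ρ σ τ,
    G (tensorOp (tensIso (tens a b) c) (tensorOp (tensIso a b) ρ σ) τ) =
      tensorOp (tensIso a (tens b c)) ρ (tensorOp (tensIso b c) σ τ)
  assoc_symm_mem : ∀ a b c, ∃ G ∈ free (tens a (tens b c)) (tens (tens a b) c), ∀ ρ σ τ,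
    G (tensorOp (tensIso a (tens b c)) ρ (tensorOp (tensIso b c) σ τ)) =
      tensorOp (tensIso (tens a b) c) (tensorOp (tensIso a b) ρ σ) τ
  unit_right_mem : ∀ a, ∃ G ∈ free (tens a one) a, ∀ ρ,
    G (tensorOp (tensIso a one) ρ ⟨1, one_mem_traceClass finrank_one⟩) = ρ
  unit_right_symm_mem : ∀ a, ∃ G ∈ free a (tens a one), ∀ ρ,
    G ρ = tensorOp (tensIso a one) ρ ⟨1, one_mem_traceClass finrank_one⟩
  unit_left_mem : ∀ a, ∃ G ∈ free (tens one a) a, ∀ ρ,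
    G (tensorOp (tensIso one a) ⟨1, one_mem_traceClass finrank_one⟩ ρ) = ρ
  unit_left_symm_mem : ∀ a, ∃ G ∈ free a (tens one a), ∀ ρ,
    G ρ = tensorOp (tensIso one a) ⟨1, one_mem_traceClass finrank_one⟩ ρ

namespace ResourceTheory

attribute [instance] ResourceTheory.normed ResourceTheory.innerProduct ResourceTheory.complete

variable (R : ResourceTheory.{u, v})

/-- The system `a^{⊗ n}`. -/
def pow (a : R.Sys) : ℕ → R.Sys
  | 0 => R.one
  | n + 1 => R.tens (pow a n) a

/-- The operator `ρ^{⊗ n}`, with `ρ^{⊗ 0} = 1`. -/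
def opPow {a : R.Sys} (ρ : traceClass (R.space a)) : (n : ℕ) → traceClass (R.space (R.pow a n))
  | 0 => ⟨1, one_mem_traceClass R.finrank_one⟩
  | n + 1 => tensorOp (R.tensIso (R.pow a n) a) (opPow ρ n) ρ

/-- The set `ℛ(φ → ψ)` of asymptotically achievable rates. -/
def achievableRates {a b : R.Sys} (φ : DensityOperator (R.space a))
    (ψ : DensityOperator (R.space b)) : Set ℝ≥0 :=
  {r | ∃ N : (n : ℕ) → Channel (R.space (R.pow a n)) (R.space (R.pow b ⌈r * (n : ℝ≥0)⌉₊)),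
    (∀ n : ℕ, N n ∈ R.free (R.pow a n) (R.pow b ⌈r * (n : ℝ≥0)⌉₊)) ∧
    Filter.liminf (fun n : ℕ => traceNorm
      ((N n (R.opPow φ.op n) - R.opPow ψ.op ⌈r * (n : ℝ≥0)⌉₊ : traceClass (R.space (R.pow b ⌈r * (n : ℝ≥0)⌉₊))) :
        R.space (R.pow b ⌈r * (n : ℝ≥0)⌉₊) →L[ℂ] R.space (R.pow b ⌈r * (n : ℝ≥0)⌉₊))) Filter.atTop = 0}

/-- The asymptotic conversion rate `r_conv(φ → ψ) = sup ℛ(φ → ψ)`, in `[0, ∞]`. -/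
def convRate {a b : R.Sys} (φ : DensityOperator (R.space a)) (ψ : DensityOperator (R.space b)) :
    ℝ≥0∞ :=
  ⨆ r ∈ R.achievableRates φ ψ, (r : ℝ≥0∞)

end ResourceTheory

end QRT

end

/-! The rate 1 is always achieved, by doing nothing, so it remains to show that one achievable rate
r > 1 makes every rate s achievable. Suppose that n copies of ψ are converted to n + d copies with
error ε, where d ≥ (r - 1)n. Applying the same operation again to n of the n + d output copies, with
the identity on the other d, gains another d copies. After k rounds there are n + kd copies. Errors
only add up, to kε at most: a channel cannot increase the trace norm of the earlier error
(`Converts.trans`), and idle copies of ψ do not change the error of a round (`Converts.succ`).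
Choosing k with k(r - 1) ≥ s leaves at least sn copies, and tracing out the surplus is free
(`converts_of_le`).

The number k depends on r and s but not on n, and all k rounds use the operation for the same n.
Hence an error that is small only for infinitely many n, which is all that the `liminf` provides,
stays small for those n. -/

namespace QRT

/-! ### Contractivity of channels in trace norm -/

section TraceNorm

variable {H K L : Type*} [NormedAddCommGroup H] [InnerProductSpace ℂ H] [CompleteSpace H]
  [NormedAddCommGroup K] [InnerProductSpace ℂ K] [CompleteSpace K]
  [NormedAddCommGroup L] [InnerProductSpace ℂ L] [CompleteSpace L]

theorem nonneg_iff_inner (T : H →L[ℂ] H) : 0 ≤ T ↔ ∀ v, 0 ≤ ⟪v, T v⟫_ℂ := by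
  rw [ContinuousLinearMap.nonneg_iff_isPositive]
  refine ⟨fun h v => h.inner_nonneg_right v, fun h => ?_⟩
  rw [ContinuousLinearMap.isPositive_iff_complex]
  intro v
  have h1 := h v
  -- In the order on `ℂ`, `0 ≤ z` includes that z is real. This supplies the self-adjointness of
  -- `T`, which is not assumed separately.
  rw [← inner_conj_symm, Complex.le_def] at h1
  simp only [Complex.zero_re, Complex.zero_im, Complex.conj_re, Complex.conj_im] at h1
  refine ⟨?_, h1.1⟩
  apply Complex.ext
  · simp
  · simp only [RCLike.re_to_complex, Complex.ofReal_im]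
    linarith [h1.2]

theorem traceNorm_of_nonneg {T : H →L[ℂ] H} (hT : 0 ≤ T) :
    traceNorm T = ∑' i, ENNReal.ofReal (RCLike.re ⟪basis H i, T (basis H i)⟫_ℂ) := by
  rw [traceNorm, CFC.abs_of_nonneg T hT]

/-- The trace norm of a positive operator is its trace. -/
theorem traceNorm_eq_trace {T : traceClass H} (hT : 0 ≤ (T : H →L[ℂ] H)) :
    traceNorm (T : H →L[ℂ] H) = ENNReal.ofReal (trace T).re := by
  have hpos := (nonneg_iff_inner (T : H →L[ℂ] H)).1 hT
  have hfin : ∑' i, ENNReal.ofReal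
      (RCLike.re ⟪basis H i, (T : H →L[ℂ] H) (basis H i)⟫_ℂ) ≠ ⊤ := by
    rw [← traceNorm_of_nonneg hT]
    exact T.2.ne
  have hre : ∀ i, 0 ≤ RCLike.re ⟪basis H i, (T : H →L[ℂ] H) (basis H i)⟫_ℂ :=
    fun i => (Complex.le_def.1 (hpos (basis H i))).1
  have hsum : Summable fun i => RCLike.re ⟪basis H i, (T : H →L[ℂ] H) (basis H i)⟫_ℂ := by
    have h := ENNReal.summable_toReal hfin
    simpa only [ENNReal.toReal_ofReal (hre _)] using h
  have htr : trace T =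
      ((∑' i, RCLike.re ⟪basis H i, (T : H →L[ℂ] H) (basis H i)⟫_ℂ : ℝ) : ℂ) := by
    rw [trace, Complex.ofReal_tsum]
    exact tsum_congr fun i => Complex.ext rfl (Complex.le_def.1 (hpos (basis H i))).2.symm
  rw [htr, Complex.ofReal_re, traceNorm_of_nonneg hT, ENNReal.ofReal_tsum_of_nonneg hre hsum]

theorem traceNorm_neg (T : H →L[ℂ] H) : traceNorm (-T) = traceNorm T := by
  simp [traceNorm]

/-- For self-adjoint `T` one has `|T| = T⁺ + T⁻`, and the diagonal entries of both parts are
nonnegative, so the sums can be split in `[0, ∞]` without any trace-class assumption. -/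
theorem traceNorm_eq_posPart_add_negPart {T : H →L[ℂ] H} (hT : IsSelfAdjoint T) :
    traceNorm T = traceNorm T⁺ + traceNorm T⁻ := by
  have hp := CFC.posPart_nonneg T
  have hn := CFC.negPart_nonneg T
  rw [traceNorm_of_nonneg hp, traceNorm_of_nonneg hn, ← ENNReal.tsum_add, traceNorm]
  refine tsum_congr fun i => ?_
  have h1 : 0 ≤ RCLike.re ⟪basis H i, T⁺ (basis H i)⟫_ℂ :=
    (Complex.le_def.1 ((nonneg_iff_inner _).1 hp _)).1
  have h2 : 0 ≤ RCLike.re ⟪basis H i, T⁻ (basis H i)⟫_ℂ :=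
    (Complex.le_def.1 ((nonneg_iff_inner _).1 hn _)).1
  rw [← ENNReal.ofReal_add h1 h2, ← CFC.posPart_add_negPart T hT]
  simp

/-- This is complete positivity for 1 × 1 block matrices. -/
theorem Channel.map_nonneg (E : Channel H K) {T : traceClass H} (hT : 0 ≤ (T : H →L[ℂ] H)) :
    0 ≤ (E T : K →L[ℂ] K) := by
  rw [nonneg_iff_inner]
  intro v
  have h : BlockNonneg fun _ _ : Fin 1 => T := fun w => by
    simpa using (nonneg_iff_inner _).1 hT (w 0)
  simpa using E.completely_positive 1 _ h fun _ => v

theorem Channel.traceNorm_map_of_nonneg (E : Channel H K) {T : traceClass H}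
    (hT : 0 ≤ (T : H →L[ℂ] H)) : traceNorm (E T : K →L[ℂ] K) = traceNorm (T : H →L[ℂ] H) := by
  rw [traceNorm_eq_trace hT, traceNorm_eq_trace (E.map_nonneg hT), E.trace_preserving]

/-- Channels are contractions for the trace norm on self-adjoint operators. -/
theorem Channel.traceNorm_map_le (E : Channel H K) {T : traceClass H}
    (hT : IsSelfAdjoint (T : H →L[ℂ] H)) :
    traceNorm (E T : K →L[ℂ] K) ≤ traceNorm (T : H →L[ℂ] H) := by
  have h := traceNorm_eq_posPart_add_negPart hT
  have htop : traceNorm (T : H →L[ℂ] H) < ⊤ := T.2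
  rw [h, ENNReal.add_lt_top] at htop
  -- The Jordan parts are themselves trace class, so the channel can act on each; it preserves their
  -- trace norms because they are positive.
  let P : traceClass H := ⟨_, htop.1⟩
  let N : traceClass H := ⟨_, htop.2⟩
  have hPN : T = P - N := Subtype.ext (CFC.posPart_sub_negPart _ hT).symm
  have hE : (E T : K →L[ℂ] K) = E P + -(E N : K →L[ℂ] K) := by
    rw [hPN, map_sub, Submodule.coe_sub, sub_eq_add_neg]
  rw [h, hE]
  refine (traceNorm_add_le _ _).trans_eq ?_
  rw [traceNorm_neg, E.traceNorm_map_of_nonneg (T := P) (CFC.posPart_nonneg _),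
    E.traceNorm_map_of_nonneg (T := N) (CFC.negPart_nonneg _)]

theorem vecTensor_sub_left (U : HilbertTensor H K ≃ₗᵢ[ℂ] L) (x x' : H) (y : K) :
    vecTensor U (x - x') y = vecTensor U x y - vecTensor U x' y := by
  rw [vecTensor, TensorProduct.sub_tmul, UniformSpace.Completion.coe_sub, map_sub]
  rfl

theorem tensorOp_sub_left (U : HilbertTensor H K ≃ₗᵢ[ℂ] L) (A A' : traceClass H)
    (B : traceClass K) : tensorOp U (A - A') B = tensorOp U A B - tensorOp U A' B := by
  refine Subtype.ext (ext_vecTensor U fun x y => ?_)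
  change opTensor U ((A : H →L[ℂ] H) - A') B _ = opTensor U A B _ - opTensor U A' B _
  simp only [opTensor_vecTensor, sub_apply, vecTensor_sub_left]

theorem DensityOperator.traceNorm_op (ψ : DensityOperator H) :
    traceNorm (ψ.op : H →L[ℂ] H) = 1 := by
  rw [traceNorm_eq_trace ψ.nonneg, ψ.trace_eq_one, Complex.one_re, ENNReal.ofReal_one]

end TraceNorm

/-! ### Calculus of approximate conversions between powers of ψ -/

namespace ResourceTheory

variable (R : ResourceTheory.{u, v}) {a : R.Sys} (ψ : DensityOperator (R.space a))

theorem opPow_nonneg (n : ℕ) :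
    0 ≤ (R.opPow ψ.op n : R.space (R.pow a n) →L[ℂ] R.space (R.pow a n)) := by
  induction n with
  | zero => exact zero_le_one
  | succ n ih => exact opTensor_nonneg _ ih ψ.nonneg

/-- The distance between `G(ψ^{⊗ n})` and `ψ^{⊗ m}`. -/
noncomputable def conversionError {n m : ℕ} (G : Channel (R.space (R.pow a n)) (R.space (R.pow a m))) : ℝ≥0∞ :=
  traceNorm ((G (R.opPow ψ.op n) - R.opPow ψ.op m : traceClass (R.space (R.pow a m))) :
    R.space (R.pow a m) →L[ℂ] R.space (R.pow a m))

/-- `n` copies of `ψ` can be freely converted to `m` copies with error at most `ε`. -/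
def Converts (n m : ℕ) (ε : ℝ≥0∞) : Prop :=
  ∃ G ∈ R.free (R.pow a n) (R.pow a m), R.conversionError ψ G ≤ ε

theorem Converts.of_eq {n m : ℕ}
    {G : Channel (R.space (R.pow a n)) (R.space (R.pow a m))}
    (hG : G ∈ R.free (R.pow a n) (R.pow a m)) (h : G (R.opPow ψ.op n) = R.opPow ψ.op m) :
    R.Converts ψ n m 0 := by
  refine ⟨G, hG, ?_⟩
  rw [conversionError, h, sub_self]
  simp [traceNorm]

theorem Converts.refl (n : ℕ) : R.Converts ψ n n 0 :=
  .of_eq R ψ (R.id_mem _) rfl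

variable {R ψ}

/-- The second operation meets an imperfect input. Its deviation from the ideal input is a
difference of positive operators, hence self-adjoint, and contractivity keeps its contribution to
the final error below `ε`. -/
theorem Converts.trans {n m l : ℕ} {ε δ : ℝ≥0∞} (h : R.Converts ψ n m ε)
    (h' : R.Converts ψ m l δ) : R.Converts ψ n l (ε + δ) := by
  obtain ⟨M, hM, hMε⟩ := h
  obtain ⟨N, hN, hNδ⟩ := h'
  refine ⟨N.comp M, R.comp_mem hM hN, ?_⟩
  have hsa : IsSelfAdjoint ((M (R.opPow ψ.op n) - R.opPow ψ.op m :
      traceClass (R.space (R.pow a m))) : R.space (R.pow a m) →L[ℂ] R.space (R.pow a m)) :=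
    (M.map_nonneg (R.opPow_nonneg ψ n)).isSelfAdjoint.sub (R.opPow_nonneg ψ m).isSelfAdjoint
  have hsplit : (N.comp M) (R.opPow ψ.op n) - R.opPow ψ.op l =
      N (M (R.opPow ψ.op n) - R.opPow ψ.op m) + (N (R.opPow ψ.op m) - R.opPow ψ.op l) := by
    rw [map_sub, sub_add_sub_cancel]
    rfl
  rw [conversionError, hsplit, Submodule.coe_add]
  exact (traceNorm_add_le _ _).trans (add_le_add ((N.traceNorm_map_le hsa).trans hMε) hNδ)

/-- The error operator is merely tensored with ψ, which has trace norm 1. As `pow` adds its new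
factor on the right, tensoring with the identity on the right needs no associator. -/
theorem Converts.succ {n m : ℕ} {ε : ℝ≥0∞} (h : R.Converts ψ n m ε) :
    R.Converts ψ (n + 1) (m + 1) ε := by
  obtain ⟨M, hM, hMε⟩ := h
  obtain ⟨G, hG, hGM⟩ : ∃ G ∈ R.free (R.pow a (n + 1)) (R.pow a (m + 1)),
      G (R.opPow ψ.op (n + 1)) =
        tensorOp (R.tensIso (R.pow a m) a) (M (R.opPow ψ.op n)) ψ.op := by
    obtain ⟨G, hG, hGM⟩ := R.tensor_mem hM (R.id_mem a)
    exact ⟨G, hG, hGM _ _⟩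
  refine ⟨G, hG, ?_⟩
  have hsplit : G (R.opPow ψ.op (n + 1)) - R.opPow ψ.op (m + 1) =
      tensorOp (R.tensIso (R.pow a m) a) (M (R.opPow ψ.op n) - R.opPow ψ.op m) ψ.op := by
    rw [tensorOp_sub_left, hGM]
    rfl
  rw [conversionError, hsplit]
  refine (traceNorm_opTensor _ _ _).trans_le ?_
  rw [ψ.traceNorm_op, mul_one]
  exact hMε

theorem Converts.add_right {n m : ℕ} {ε : ℝ≥0∞} (h : R.Converts ψ n m ε) (p : ℕ) :
    R.Converts ψ (n + p) (m + p) ε := by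
  induction p with
  | zero => exact h
  | succ p ih => exact ih.succ

variable (R ψ)

/-- Tracing out the last copy leaves a trivial factor `ℂ`, which the right unit isomorphism removes.
-/
theorem converts_discard (m : ℕ) : R.Converts ψ (m + 1) m 0 := by
  obtain ⟨T, hT, hTρ⟩ := R.trace_mem a
  obtain ⟨G, hG, hGρ⟩ := R.tensor_mem (R.id_mem (R.pow a m)) hT
  obtain ⟨U, hU, hUρ⟩ := R.unit_right_mem (R.pow a m)
  refine .of_eq R ψ (R.comp_mem hG hU) ?_
  have h1 : T ψ.op = ⟨1, one_mem_traceClass R.finrank_one⟩ :=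
    Subtype.ext ((hTρ _).trans (by rw [ψ.trace_eq_one, one_smul]))
  have h2 := hGρ (R.opPow ψ.op m) ψ.op
  rw [h1] at h2
  exact (congrArg U h2).trans (hUρ _)

theorem converts_of_le {n m : ℕ} (h : m ≤ n) : R.Converts ψ n m 0 := by
  induction n, h using Nat.le_induction with
  | base => exact .refl R ψ m
  | succ n _ ih => simpa using (R.converts_discard ψ n).trans ih

variable {R ψ}

theorem Converts.iterate {n d : ℕ} {ε : ℝ≥0∞} (h : R.Converts ψ n (n + d) ε) (k : ℕ) :
    R.Converts ψ n (n + k * d) (k * ε) := by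
  induction k with
  | zero => simpa using Converts.refl R ψ n
  | succ k ih =>
    -- The next round acts on `n` copies while the `k * d` copies gained so far stay idle.
    have h1 := ih.trans (h.add_right (k * d))
    rwa [show n + d + k * d = n + (k + 1) * d by ring,
      show (k : ℝ≥0∞) * ε + ε = ((k + 1 : ℕ) : ℝ≥0∞) * ε by push_cast; ring] at h1

/-! ### Achievable rates and the dichotomy -/

theorem mem_achievableRates {r : ℝ≥0} {ε : ℕ → ℝ≥0∞}
    (h : ∀ n : ℕ, R.Converts ψ n ⌈r * (n : ℝ≥0)⌉₊ (ε n))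
    (hε : Filter.liminf ε Filter.atTop = 0) : r ∈ R.achievableRates ψ ψ := by
  choose N hN hNε using h
  exact ⟨N, hN, le_antisymm ((Filter.liminf_le_liminf (.of_forall hNε)).trans_eq hε) bot_le⟩

theorem one_mem_achievableRates : 1 ∈ R.achievableRates ψ ψ := by
  refine mem_achievableRates (ε := fun _ => 0) (fun n => ?_) (by simp)
  rw [one_mul, Nat.ceil_natCast]
  exact .refl R ψ n

/-- If some rate above one is achievable, then every rate is. -/
theorem mem_achievableRates_of_one_lt {r : ℝ≥0} (hr : r ∈ R.achievableRates ψ ψ) (h1 : 1 < r)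
    (s : ℝ≥0) : s ∈ R.achievableRates ψ ψ := by
  obtain ⟨N, hN, hlim⟩ := hr
  -- Each round gains at least `(r - 1) * n` copies, so this many rounds gain at least `s * n`,
  -- uniformly in `n`.
  obtain ⟨k, hk⟩ := exists_nat_ge (s / (r - 1))
  have hks : s ≤ k * (r - 1) := by
    rwa [div_le_iff₀ (tsub_pos_of_lt h1)] at hk
  refine mem_achievableRates (ε := fun n => k * R.conversionError ψ (N n)) (fun n => ?_) ?_
  · have hle : n ≤ ⌈r * (n : ℝ≥0)⌉₊ := by
      have : (n : ℝ≥0) ≤ ⌈r * (n : ℝ≥0)⌉₊ :=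
        (le_mul_of_one_le_left (zero_le) h1.le).trans (Nat.le_ceil _)
      exact_mod_cast this
    obtain ⟨d, hd⟩ := Nat.exists_eq_add_of_le hle
    have hconv : R.Converts ψ n (n + d) (R.conversionError ψ (N n)) := by
      rw [← hd]
      exact ⟨N n, hN n, le_rfl⟩
    have hdn : (r - 1) * n ≤ (d : ℝ≥0) := by
      have h2 := Nat.le_ceil (r * (n : ℝ≥0))
      rw [hd] at h2
      rw [tsub_mul, one_mul, tsub_le_iff_left]
      exact_mod_cast h2
    -- The gained copies alone suffice: `k * d` is an integer above `s * n`, so rounding up costs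
    -- nothing.
    have hsk : ⌈s * (n : ℝ≥0)⌉₊ ≤ n + k * d := by
      rw [Nat.ceil_le]
      calc s * n ≤ k * (r - 1) * n := by gcongr
        _ = k * ((r - 1) * n) := mul_assoc _ _ _
        _ ≤ k * d := by gcongr
        _ ≤ ((n + k * d : ℕ) : ℝ≥0) := by push_cast; exact le_add_self
    simpa using (hconv.iterate k).trans (R.converts_of_le ψ hsk)
  -- The finite constant `k` comes out of the `liminf` because it does not depend on `n`.
  · rw [ENNReal.liminf_const_mul_of_ne_top (ENNReal.natCast_ne_top k)]
    exact mul_eq_zero_of_right _ hlim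

end ResourceTheory

end QRT

theorem mainTheorem3 (R : QRT.ResourceTheory.{u, v}) (a : R.Sys)
    (ψ : QRT.DensityOperator (R.space a)) :
    R.convRate ψ ψ = 1 ∨ R.convRate ψ ψ = ⊤ := by
  by_cases h : ∃ r ∈ R.achievableRates ψ ψ, 1 < r
  · obtain ⟨r, hr, h1⟩ := h
    refine Or.inr (ENNReal.eq_top_of_forall_nnreal_le fun s => ?_)
    exact le_iSup₂ (f := fun (t : NNReal) (_ : t ∈ R.achievableRates ψ ψ) => (t : ENNReal)) s
      (QRT.ResourceTheory.mem_achievableRates_of_one_lt hr h1 s)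
  · push Not at h
    refine Or.inl (le_antisymm (iSup₂_le fun r hr => ?_) ?_)
    · exact_mod_cast h r hr
    · exact le_iSup₂ (f := fun (t : NNReal) (_ : t ∈ R.achievableRates ψ ψ) => (t : ENNReal)) 1
        QRT.ResourceTheory.one_mem_achievableRates
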